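/- Let $\mathbb{P}_4$ be the set of positive definite (Hermitian) $4\times4$ complex matrices, let $\mathrm{Tr}$ be the usual trace, and let real powers of positive definite matrices be defined by functional calculus. (1) Let $p,s\in\mathbb{R}$ with $p,s\neq0$. If, for every $X\in\mathbb{P}_4$, the function $A\in\mathbb{P}_4\mapsto\mathrm{Tr}\,\bigl((X^*A^pX)^s\bigr)$ is convex, then at least one of the following four conditions holds: - $-1\le p<0$ and $s>0$; - $1\le p\le2$ and $s\ge1/p$; - $-1\le -p<0$ and $-s>0$; - $1\le -p\le2$ and $-s\ge1/(-p)$. (2) Let $p,q,s\in\mathbb{R}$ with $p,q,s\neq0$. If the function $(A,B)\in\mathbb{P}_4\times\mathbb{P}_4\mapsto\mathrm{Tr}\,\bigl((A^{p/2}B^qA^{p/2})^s\bigr)$ is jointly convex, then at least one of the following six conditions holds: - $-1\le p<0$, $-1\le q<0$ and $s>0$; - $-1\le p<0$, $1\le q\le2$, $p+q>0$ and $s\ge1/(p+q)$; - $1\le p\le2$, $-1\le q<0$, $p+q>0$ and $s\ge1/(p+q)$; - $-1\le -p<0$, $-1\le -q<0$ and $-s>0$; - $-1\le -p<0$, $1\le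 -q\le2$, $-p-q>0$ and $-s\ge1/(-p-q)$; - $1\le -p\le2$, $-1\le -q<0$, $-p-q>0$ and $-s\ge1/(-p-q)$. -/

import Mathlib

open scoped MatrixOrder ComplexOrder

noncomputable section

/-- The `4 × 4` complex matrices. -/
abbrev M4 : Type := Matrix (Fin 4) (Fin 4) ℂ

/-- The set of positive definite (Hermitian) `4 × 4` complex matrices. -/
def P4 : Set M4 := {A | A.PosDef}

/-- The function `A ↦ Tr (X* A^p X)^s`. The real powers are those of the continuous functional
calculus. For `A` positive definite and `X` invertible the trace is a positive real number,
which `Complex.re` reads as a real number. -/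
def epsteinTrace (p s : ℝ) (X A : M4) : ℝ :=
  (Matrix.trace ((star X * A ^ p * X) ^ s)).re

/-- The function `(A, B) ↦ Tr (A^(p/2) B^q A^(p/2))^s`, with the same conventions. -/
def liebTrace (p q s : ℝ) (Z : M4 × M4) : ℝ :=
  (Matrix.trace ((Z.1 ^ (p / 2) * Z.2 ^ q * Z.1 ^ (p / 2)) ^ s)).re

end

/-! For `s < 0`, inverting the matrix inside the trace turns `(p, s)` into `(-p, -s)` and `X` into
`X⁻¹`, so only `s > 0` matters.

Let `X` tend to a rank-one matrix `v v*`. The trace becomes `(⟨v, A^p v⟩ ‖v‖²)^s`, so `A ↦ ⟨v, A^p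
v⟩^s` is midpoint convex. If `A` is a 2×2 block plus an identity, the remaining coordinates of `v`
add an arbitrary constant `c > 0` to the quadratic form. For `c → ∞` the function `(x + c)^s` is
affine to first order, and the power `s` disappears: the 2×2 blocks satisfy the midpoint inequality
for operator convexity of `x^p` (`block_inequality`). Two blocks whose off-diagonal entries cancel,
with one eigenvalue degenerating to `0` or `∞`, then force 2^(p-2) or 2^p below a harmonic mean,
which fails for `p > 2` and `p < -1` respectively. Diagonal blocks exclude `0 < p < 1`, and scalar
matrices give `p s ≥ 1` when `p > 0`.

In two variables, fixing one matrix reduces to the one-variable problem, because `B^(q/2)` and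
`A^(p/2)` range over all positive definite matrices. On scalar matrices the function is `4 a^(ps)
b^(qs)`; its convexity excludes `p, q > 0` and yields `(p + q) s ≥ 1` for mixed signs. -/

/-! ### Real powers of matrices and intertwining relations -/

open Polynomial in
/-- Every real function agrees with a polynomial on a finite set. -/
theorem exists_polynomial_eqOn {S : Set ℝ} (hS : S.Finite) (f : ℝ → ℝ) :
    ∃ q : ℝ[X], ∀ x ∈ S, q.eval x = f x :=
  ⟨Lagrange.interpolate hS.toFinset id f, fun _ hx =>
    Lagrange.eval_interpolate_at_node (v := id) f (Set.injOn_id _) (hS.mem_toFinset.2 hx)⟩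

open Polynomial in
theorem aeval_intertwine {P A D : M4} (h : P * D = A * P) (q : ℝ[X]) :
    P * aeval D q = aeval A q * P := by
  induction q using Polynomial.induction_on' with
  | add f g hf hg => simp [mul_add, add_mul, hf, hg]
  | monomial n a =>
    have : SemiconjBy P D A := h
    simp only [aeval_monomial, Algebra.algebraMap_eq_smul_one, smul_mul_assoc, one_mul,
      mul_smul_comm]
    rw [(this.pow_right n).eq]

open Polynomial in
/-- Real powers of positive semidefinite matrices respect intertwining relations. -/
theorem rpow_intertwine {P A D : M4} (hA : 0 ≤ A) (hD : 0 ≤ D) (h : P * D = A * P) (s : ℝ) :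
    P * D ^ s = A ^ s * P := by
  -- One polynomial must represent the power on both spectra at once, so that the polynomial
  -- intertwining applies.
  obtain ⟨q, hq⟩ := exists_polynomial_eqOn
    ((Matrix.finite_real_spectrum (A := A)).union (Matrix.finite_real_spectrum (A := D)))
    (fun x => x ^ s)
  have key : ∀ B : M4, 0 ≤ B → (∀ x ∈ spectrum ℝ B, q.eval x = x ^ s) → B ^ s = aeval B q := by
    intro B hB hx
    rw [CFC.rpow_eq_cfc_real hB, ← cfc_polynomial q B (IsSelfAdjoint.of_nonneg hB)]
    exact cfc_congr fun x hx' => (hx x hx').symm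
  rw [key A hA fun x hx => hq x (Or.inl hx), key D hD fun x hx => hq x (Or.inr hx)]
  exact aeval_intertwine h q

theorem rpow_smul_one {c : ℝ} (hc : 0 ≤ c) (s : ℝ) :
    ((c : ℂ) • (1 : M4)) ^ s = ((c ^ s : ℝ) : ℂ) • (1 : M4) := by
  lift c to NNReal using hc
  have h := CFC.rpow_algebraMap (A := M4) (x := c) (y := s)
  have e : ∀ r : NNReal, algebraMap NNReal M4 r = ((r : ℝ) : ℂ) • (1 : M4) := fun r => by
    rw [Algebra.algebraMap_eq_smul_one]; rfl
  rw [e, e] at h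
  simpa using h

theorem smul_one_nonneg {c : ℝ} (hc : 0 ≤ c) : (0 : M4) ≤ (c : ℂ) • (1 : M4) :=
  smul_nonneg (by exact_mod_cast hc) zero_le_one

theorem rpow_mul_eq_smul {A P : M4} (hA : 0 ≤ A) {c : ℝ} (hc : 0 ≤ c)
    (h : A * P = (c : ℂ) • P) (s : ℝ) : A ^ s * P = ((c ^ s : ℝ) : ℂ) • P := by
  have := rpow_intertwine (P := P) hA (smul_one_nonneg hc) (by simp [h]) s
  rw [← this, rpow_smul_one hc]; simp

theorem rpow_mulVec_eq_smul {A : M4} (hA : 0 ≤ A) {c : ℝ} (hc : 0 ≤ c) {x : Fin 4 → ℂ}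
    (h : A.mulVec x = (c : ℂ) • x) (s : ℝ) : (A ^ s).mulVec x = ((c ^ s : ℝ) : ℂ) • x := by
  -- The matrix all of whose columns are `x` carries the eigenvector equation into matrix form.
  have h1 : A * Matrix.vecMulVec x (1 : Fin 4 → ℂ) = (c : ℂ) • Matrix.vecMulVec x 1 := by
    rw [Matrix.mul_vecMulVec, h, Matrix.smul_vecMulVec]
  have h2 := rpow_mul_eq_smul hA hc h1 s
  rw [Matrix.mul_vecMulVec, ← Matrix.smul_vecMulVec] at h2
  ext i
  simpa [Matrix.vecMulVec_apply] using congrFun (congrFun h2 i) 0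

theorem posDef_rpow {A : M4} (hA : A.PosDef) (s : ℝ) : (A ^ s).PosDef :=
  Matrix.isStrictlyPositive_iff_posDef.1 (hA.isStrictlyPositive.rpow A s)

theorem rpow_neg_eq_inv_rpow {A : M4} (hA : A.PosDef) (s : ℝ) : A ^ (-s) = A⁻¹ ^ s := by
  have := CFC.rpow_neg hA.isUnit.unit s (by simpa using hA.posSemidef.nonneg)
  rw [Matrix.coe_units_inv] at this
  simpa using this

theorem rpow_neg_eq_rpow_inv {A : M4} (hA : A.PosDef) (s : ℝ) : A ^ (-s) = (A ^ s)⁻¹ := by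
  symm
  apply Matrix.inv_eq_left_inv
  rw [← CFC.rpow_add hA.isUnit]
  simp [CFC.rpow_zero A hA.posSemidef.nonneg]

theorem posDef_star_mul_mul {A X : M4} (hA : A.PosDef) (hX : IsUnit X) :
    (star X * A * X).PosDef :=
  (Matrix.IsUnit.posDef_star_left_conjugate_iff hX).2 hA

/-! ### Symmetries of the trace functions and their values on scalar matrices -/

/-- `Tr (M* M)^s = Tr (M M*)^s` for invertible `M`. -/
theorem trace_rpow_star_mul_self {M : M4} (hM : IsUnit M) (s : ℝ) :
    ((star M * M) ^ s).trace = ((M * star M) ^ s).trace := by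
  have h := rpow_intertwine (P := M) (A := M * star M) (D := star M * M)
    (mul_star_self_nonneg M) (star_mul_self_nonneg M) (by simp [mul_assoc]) s
  have hd : IsUnit M.det := (Matrix.isUnit_iff_isUnit_det M).1 hM
  have e : (star M * M) ^ s = M⁻¹ * ((M * star M) ^ s * M) := by
    rw [← h, ← mul_assoc, Matrix.nonsing_inv_mul M hd, one_mul]
  rw [e, Matrix.trace_mul_comm, mul_assoc, Matrix.mul_nonsing_inv M hd, mul_one]

/-- The power `-s` is the power `s` of the inverse, and `(X A^(-p) X)⁻¹ = X⁻¹ A^p X⁻¹`. This reduces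
negative `s` to positive `s`. -/
theorem epsteinTrace_neg {X A : M4} (hX : X.PosDef) (hA : A.PosDef) (p s : ℝ) :
    epsteinTrace (-p) (-s) X A = epsteinTrace p s X⁻¹ A := by
  unfold epsteinTrace
  have hX' : star X = X := hX.isHermitian
  have hXi : star X⁻¹ = X⁻¹ := hX.inv.isHermitian
  have h := posDef_star_mul_mul (posDef_rpow hA (-p)) hX.isUnit
  rw [rpow_neg_eq_inv_rpow h, hX', hXi, Matrix.mul_inv_rev, Matrix.mul_inv_rev,
    rpow_neg_eq_rpow_inv hA, Matrix.nonsing_inv_nonsing_inv _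
      ((Matrix.isUnit_iff_isUnit_det _).1 (posDef_rpow hA p).isUnit), mul_assoc]

theorem liebTrace_neg {A B : M4} (hA : A.PosDef) (hB : B.PosDef) (p q s : ℝ) :
    liebTrace (-p) (-q) (-s) (A, B) = liebTrace p q s (A, B) := by
  unfold liebTrace
  have hAs : ∀ r : ℝ, star (A ^ r) = A ^ r := fun r => (posDef_rpow hA r).isHermitian
  have h := posDef_star_mul_mul (posDef_rpow hB (-q)) (posDef_rpow hA (-p / 2)).isUnit
  rw [hAs] at h
  dsimp only
  rw [rpow_neg_eq_inv_rpow h, Matrix.mul_inv_rev, Matrix.mul_inv_rev, neg_div,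
    rpow_neg_eq_rpow_inv hA, rpow_neg_eq_rpow_inv hB, Matrix.nonsing_inv_nonsing_inv _
      ((Matrix.isUnit_iff_isUnit_det _).1 (posDef_rpow hA _).isUnit), Matrix.nonsing_inv_nonsing_inv _
      ((Matrix.isUnit_iff_isUnit_det _).1 (posDef_rpow hB _).isUnit), mul_assoc]

theorem rpow_half_mul_self {A : M4} (hA : A.PosDef) (p : ℝ) :
    A ^ (p / 2) * A ^ (p / 2) = A ^ p := by
  rw [← CFC.rpow_add hA.isUnit, add_halves]

theorem liebTrace_eq_epsteinTrace_right {A B : M4} (hA : A.PosDef) (p q s : ℝ) :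
    liebTrace p q s (A, B) = epsteinTrace q s (A ^ (p / 2)) B := by
  have hAs : star (A ^ (p / 2)) = A ^ (p / 2) := (posDef_rpow hA _).isHermitian
  simp [liebTrace, epsteinTrace, hAs]

/-- With `M = B^(q/2) A^(p/2)`, the two traces are those of `(M* M)^s` and `(M M*)^s`. -/
theorem liebTrace_eq_epsteinTrace_left {A B : M4} (hA : A.PosDef) (hB : B.PosDef) (p q s : ℝ) :
    liebTrace p q s (A, B) = epsteinTrace p s (B ^ (q / 2)) A := by
  have hAs : star (A ^ (p / 2)) = A ^ (p / 2) := (posDef_rpow hA _).isHermitian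
  have hBs : star (B ^ (q / 2)) = B ^ (q / 2) := (posDef_rpow hB _).isHermitian
  have h := trace_rpow_star_mul_self
    ((posDef_rpow hB (q / 2)).isUnit.mul (posDef_rpow hA (p / 2)).isUnit) s
  simp only [star_mul, hAs, hBs] at h
  unfold liebTrace epsteinTrace
  rw [hBs, ← rpow_half_mul_self hB q, ← rpow_half_mul_self hA p]
  simp only [mul_assoc] at h ⊢
  rw [h]

theorem epsteinTrace_one_smul_one {a : ℝ} (ha : 0 < a) (p s : ℝ) :
    epsteinTrace p s 1 ((a : ℂ) • 1) = 4 * a ^ (p * s) := by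
  unfold epsteinTrace
  rw [rpow_smul_one ha.le]
  simp only [star_one, one_mul, mul_one]
  rw [rpow_smul_one (by positivity), ← Real.rpow_mul ha.le, Matrix.trace_smul, Matrix.trace_one]
  simp [mul_comm]

theorem liebTrace_smul_one {a b : ℝ} (ha : 0 < a) (hb : 0 < b) (p q s : ℝ) :
    liebTrace p q s ((a : ℂ) • 1, (b : ℂ) • 1) = 4 * (a ^ (p * s) * b ^ (q * s)) := by
  unfold liebTrace
  dsimp only
  rw [rpow_smul_one ha.le, rpow_smul_one hb.le]
  simp only [mul_smul_comm, mul_one, smul_smul]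
  rw [← Complex.ofReal_mul, ← Complex.ofReal_mul, rpow_smul_one (by positivity),
    Matrix.trace_smul, Matrix.trace_one]
  have : (a ^ (p / 2) * (b ^ q * a ^ (p / 2))) ^ s = a ^ (p * s) * b ^ (q * s) := by
    rw [mul_left_comm, ← Real.rpow_add ha, add_halves, Real.mul_rpow (by positivity) (by positivity),
      ← Real.rpow_mul ha.le, ← Real.rpow_mul hb.le, mul_comm]
  rw [← this]
  simp [mul_comm, mul_left_comm]

/-! ### Quadratic forms and the rank-one limit -/

/-- The real part of the quadratic form of `A` at `v`. -/
def quadForm (A : M4) (v : Fin 4 → ℂ) : ℝ := (star v ⬝ᵥ A.mulVec v).re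

theorem dotProduct_mulVec_eq_quadForm {A : M4} (hA : 0 ≤ A) (v : Fin 4 → ℂ) :
    star v ⬝ᵥ A.mulVec v = (quadForm A v : ℂ) := by
  have h := (Matrix.nonneg_iff_posSemidef.1 hA).dotProduct_mulVec_nonneg v
  apply Complex.ext
  · simp [quadForm]
  · simpa using (Complex.le_def.1 h).2.symm

theorem quadForm_nonneg {A : M4} (hA : 0 ≤ A) (v : Fin 4 → ℂ) : 0 ≤ quadForm A v :=
  (Complex.le_def.1 ((Matrix.nonneg_iff_posSemidef.1 hA).dotProduct_mulVec_nonneg v)).1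

theorem quadForm_one_pos {v : Fin 4 → ℂ} (hv : v ≠ 0) : 0 < quadForm 1 v :=
  (Complex.lt_def.1 (Matrix.PosDef.one.dotProduct_mulVec_pos hv)).1

theorem vecMulVec_star_nonneg (v : Fin 4 → ℂ) : (0 : M4) ≤ Matrix.vecMulVec v (star v) :=
  Matrix.nonneg_iff_posSemidef.2 (Matrix.posSemidef_vecMulVec_self_star v)

theorem vecMulVec_star_conj {A : M4} (hA : 0 ≤ A) (v : Fin 4 → ℂ) :
    star (Matrix.vecMulVec v (star v)) * A * Matrix.vecMulVec v (star v) =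
      (quadForm A v : ℂ) • Matrix.vecMulVec v (star v) := by
  have h : star (Matrix.vecMulVec v (star v)) = Matrix.vecMulVec v (star v) :=
    (IsSelfAdjoint.of_nonneg (vecMulVec_star_nonneg v)).star_eq
  rw [h, mul_assoc, Matrix.mul_vecMulVec, Matrix.vecMulVec_mul_vecMulVec,
    dotProduct_mulVec_eq_quadForm hA]
  ext i j
  simp [Matrix.vecMulVec_apply]; ring

theorem trace_vecMulVec_star (v : Fin 4 → ℂ) :
    (Matrix.vecMulVec v (star v)).trace = (quadForm 1 v : ℂ) := by
  rw [Matrix.trace_vecMulVec, ← dotProduct_mulVec_eq_quadForm zero_le_one, Matrix.one_mulVec,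
    dotProduct_comm]

theorem vecMulVec_star_mul_self (v : Fin 4 → ℂ) :
    Matrix.vecMulVec v (star v) * Matrix.vecMulVec v (star v) =
      (quadForm 1 v : ℂ) • Matrix.vecMulVec v (star v) := by
  have h := vecMulVec_star_conj zero_le_one v
  rwa [(IsSelfAdjoint.of_nonneg (vecMulVec_star_nonneg v)).star_eq, mul_one] at h

theorem trace_smul_vecMulVec_rpow {g s : ℝ} (hg : 0 ≤ g) (hs : 0 < s) {v : Fin 4 → ℂ}
    (hv : v ≠ 0) :
    (((g : ℂ) • Matrix.vecMulVec v (star v)) ^ s).trace = (((g * quadForm 1 v) ^ s : ℝ) : ℂ) := by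
  set X : M4 := Matrix.vecMulVec v (star v) with hX
  set K := quadForm 1 v
  have hK : 0 < K := quadForm_one_pos hv
  have hM : 0 ≤ (g : ℂ) • X := smul_nonneg (by exact_mod_cast hg) (vecMulVec_star_nonneg v)
  -- The matrix acts on `X` as `g K` and annihilates `K - X`. Since `0 ^ s = 0` for `s > 0`, adding
  -- the two relations determines its power `s`.
  have h1 := rpow_mul_eq_smul (P := X) hM (mul_nonneg hg hK.le)
    (by rw [smul_mul_assoc, vecMulVec_star_mul_self, smul_smul, Complex.ofReal_mul]) s
  have h2 := rpow_mul_eq_smul (P := (K : ℂ) • 1 - X) hM le_rfl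
    (by rw [mul_sub, mul_smul_comm, mul_one, smul_mul_assoc, vecMulVec_star_mul_self,
          smul_comm, sub_self]; simp) s
  rw [Real.zero_rpow hs.ne', Complex.ofReal_zero, zero_smul, mul_sub, h1, mul_smul_comm,
    mul_one, sub_eq_zero] at h2
  have h3 := congrArg Matrix.trace h2
  rw [Matrix.trace_smul, Matrix.trace_smul, trace_vecMulVec_star, smul_eq_mul, smul_eq_mul,
    mul_comm] at h3
  exact mul_right_cancel₀ (Complex.ofReal_ne_zero.2 hK.ne') h3

open scoped Matrix.Norms.L2Operator in
theorem continuousOn_rpow {s : ℝ} (hs : 0 < s) :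
    ContinuousOn (fun A : M4 => A ^ s) {A | 0 ≤ A} := by
  have h := ContinuousOn.cfc_nnreal_of_mem_nhdsSet (A := M4) (X := M4) (s := Set.univ)
    (fun x : NNReal => x ^ s) (a := id) (t := {A : M4 | 0 ≤ A}) Filter.univ_mem
    continuousOn_id (fun _ h => h)
    (NNReal.continuous_rpow_const hs.le).continuousOn
  exact h

-- The matrix `v v* + ε` is positive definite for `ε > 0`, whereas `v v*` itself is singular.
-- Positivity of `s` makes the power continuous up to singular matrices, so the limit can be
-- evaluated at `v v*`.
open Filter Topology in
theorem tendsto_epsteinTrace {A : M4} (hA : A.PosDef) {v : Fin 4 → ℂ} (hv : v ≠ 0) (p : ℝ)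
    {s : ℝ} (hs : 0 < s) :
    Tendsto (fun ε : ℝ => epsteinTrace p s (Matrix.vecMulVec v (star v) + (ε : ℂ) • 1) A)
      (𝓝[>] 0) (𝓝 ((quadForm (A ^ p) v * quadForm 1 v) ^ s)) := by
  have hnn : ∀ X : M4, 0 ≤ star X * A ^ p * X := fun X =>
    star_left_conjugate_nonneg (posDef_rpow hA p).posSemidef.nonneg X
  have hc : Continuous fun ε : ℝ => (Matrix.vecMulVec v (star v) + (ε : ℂ) • 1 : M4) := by
    fun_prop
  have hc2 : Continuous fun ε : ℝ => epsteinTrace p s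
      (Matrix.vecMulVec v (star v) + (ε : ℂ) • 1) A := by
    unfold epsteinTrace
    refine Complex.continuous_re.comp (Continuous.matrix_trace ?_)
    refine (continuousOn_rpow hs).comp_continuous ?_ fun ε => hnn _
    exact (hc.star.mul continuous_const).mul hc
  have h := hc2.tendsto 0
  have e : epsteinTrace p s (Matrix.vecMulVec v (star v) + ((0 : ℝ) : ℂ) • 1) A =
      (quadForm (A ^ p) v * quadForm 1 v) ^ s := by
    rw [Complex.ofReal_zero, zero_smul, add_zero]
    unfold epsteinTrace
    have hp := (posDef_rpow hA p).posSemidef.nonneg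
    rw [vecMulVec_star_conj hp, trace_smul_vecMulVec_rpow (quadForm_nonneg hp v) hs hv,
      Complex.ofReal_re]
  rw [e] at h
  exact h.mono_left nhdsWithin_le_nhds

theorem ConvexOn.map_midpoint {E : Type*} [AddCommGroup E] [Module ℝ E] {S : Set E} {f : E → ℝ}
    (hf : ConvexOn ℝ S f) {x y : E} (hx : x ∈ S) (hy : y ∈ S) :
    f ((2⁻¹ : ℝ) • (x + y)) ≤ (f x + f y) / 2 := by
  have h := hf.2 hx hy (by norm_num : (0 : ℝ) ≤ 2⁻¹) (by norm_num : (0 : ℝ) ≤ 2⁻¹) (by norm_num)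
  rw [← smul_add] at h
  simp only [smul_eq_mul] at h
  linarith

theorem posDef_midpoint {A B : M4} (hA : A.PosDef) (hB : B.PosDef) :
    ((2⁻¹ : ℝ) • (A + B)).PosDef :=
  (hA.add hB).smul (by norm_num)

/-- The midpoint inequality survives the rank-one limit, and the common factor `‖v‖^(2s)` cancels.
-/
theorem quadForm_rpow_midpoint_le {p s : ℝ} (hs : 0 < s)
    (h : ∀ X ∈ P4, ConvexOn ℝ P4 (fun A => epsteinTrace p s X A)) {A B : M4}
    (hA : A.PosDef) (hB : B.PosDef) {v : Fin 4 → ℂ} (hv : v ≠ 0) :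
    quadForm (((2⁻¹ : ℝ) • (A + B)) ^ p) v ^ s ≤
      (quadForm (A ^ p) v ^ s + quadForm (B ^ p) v ^ s) / 2 := by
  have hK := quadForm_one_pos hv
  have hM := posDef_midpoint hA hB
  have h1 : (quadForm (((2⁻¹ : ℝ) • (A + B)) ^ p) v * quadForm 1 v) ^ s ≤
      ((quadForm (A ^ p) v * quadForm 1 v) ^ s + (quadForm (B ^ p) v * quadForm 1 v) ^ s) / 2 := by
    refine le_of_tendsto_of_tendsto (tendsto_epsteinTrace hM hv p hs)
      (((tendsto_epsteinTrace hA hv p hs).add (tendsto_epsteinTrace hB hv p hs)).div_const 2) ?_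
    filter_upwards [self_mem_nhdsWithin] with ε hε
    refine (h _ ?_).map_midpoint hA hB
    exact Matrix.PosDef.posSemidef_add (Matrix.nonneg_iff_posSemidef.1 (vecMulVec_star_nonneg v))
      (Matrix.PosDef.one.smul (by simpa using hε))
  have hnn : ∀ {C : M4}, C.PosDef → 0 ≤ quadForm (C ^ p) v := fun hC =>
    quadForm_nonneg (posDef_rpow hC p).posSemidef.nonneg v
  rw [Real.mul_rpow (hnn hM) hK.le, Real.mul_rpow (hnn hA) hK.le, Real.mul_rpow (hnn hB) hK.le,
    ← add_mul, mul_div_right_comm] at h1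
  exact le_of_mul_le_mul_right h1 (Real.rpow_pos_of_pos hK s)

/-! ### Eliminating the exponent `s`; the 2×2 block inequality -/

open Filter Topology in
/-- Midpoint convexity of `(x + c) ^ s` for all shifts `c` linearizes. -/
theorem le_midpoint_of_rpow_shift {s x y z : ℝ} (hs : 0 < s) (hx : 0 ≤ x) (hy : 0 ≤ y)
    (hz : 0 ≤ z) (h : ∀ c : ℝ, 0 < c → (z + c) ^ s ≤ ((x + c) ^ s + (y + c) ^ s) / 2) :
    z ≤ (x + y) / 2 := by
  have hd : ∀ w : ℝ, HasDerivAt (fun ε : ℝ => (1 + ε * w) ^ s) (s * w) 0 := fun w => by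
    have h1 : HasDerivAt (fun ε : ℝ => 1 + ε * w) w 0 := by
      simpa using ((hasDerivAt_id (0 : ℝ)).mul_const w).const_add 1
    have := h1.rpow_const (p := s) (Or.inl (by simp))
    simpa [mul_comm] using this
  have hD := (((hd x).add (hd y)).div_const 2).sub (hd z)
  have ht := hD.hasDerivWithinAt (s := Set.Ioi 0)
  rw [hasDerivWithinAt_iff_tendsto_slope' (by simp)] at ht
  have hnn : 0 ≤ (s * x + s * y) / 2 - s * z := by
    refine ge_of_tendsto ht ?_
    filter_upwards [self_mem_nhdsWithin] with ε hε
    have hε : 0 < ε := hε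
    -- With `c = 1/ε`, dividing by `c^s` leaves powers `(1 + ε w)^s`, which all equal 1 at `ε = 0`
    -- and have slope `s w` there. The difference quotient is therefore nonnegative and its limit is
    -- the linear inequality.
    have key := h ε⁻¹ (by positivity)
    have e : ∀ w : ℝ, 0 ≤ w → (w + ε⁻¹) ^ s = (1 + ε * w) ^ s * ε⁻¹ ^ s := fun w hw => by
      rw [← Real.mul_rpow (by positivity) (by positivity)]
      congr 1; field_simp; ring
    rw [e x hx, e y hy, e z hz, ← add_mul, mul_div_right_comm] at key
    have key := le_of_mul_le_mul_right key (by positivity)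
    rw [slope_def_field]
    apply div_nonneg _ (by linarith)
    simp
    linarith
  nlinarith

/-- The real symmetric `2 × 2` block `(x, y; y, z)`, extended by the identity. -/
def blockMat (x y z : ℝ) : M4 :=
  !![(x : ℂ), y, 0, 0; y, z, 0, 0; 0, 0, 1, 0; 0, 0, 0, 1]

theorem posDef_blockMat {a b : ℝ} (ha : 0 < a) (hb : 0 < b) (t : ℝ) :
    (blockMat (a + b * t ^ 2) ((a - b) * t) (a * t ^ 2 + b)).PosDef := by
  -- The rows `(1, t)` and `(-t, 1)` are orthogonal of squared length `1 + t²`, so the block `P* D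
  -- P` has them as eigenvectors with eigenvalues `a (1 + t²)` and `b (1 + t²)`.
  let P : M4 := !![1, (t : ℂ), 0, 0; -t, 1, 0, 0; 0, 0, 1, 0; 0, 0, 0, 1]
  have hP : IsUnit P := by
    rw [Matrix.isUnit_iff_isUnit_det, isUnit_iff_ne_zero]
    have : P.det = ((1 + t ^ 2 : ℝ) : ℂ) := by
      simp [P, Matrix.det_succ_row_zero, Fin.sum_univ_succ, Fin.succAbove]
      ring
    rw [this]
    exact Complex.ofReal_ne_zero.2 (by positivity)
  have hD : (Matrix.diagonal ![(a : ℂ), b, 1, 1]).PosDef :=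
    Matrix.PosDef.diagonal fun i => by fin_cases i <;> simp [ha, hb]
  have h := posDef_star_mul_mul hD hP
  convert h using 1
  ext i j
  fin_cases i <;> fin_cases j <;>
    simp [P, blockMat, Matrix.mul_apply, Fin.sum_univ_four, Matrix.diagonal_apply,
      Matrix.star_apply] <;> ring

theorem quadForm_blockMat_rpow {a b : ℝ} (ha : 0 < a) (hb : 0 < b) (t u w p : ℝ) :
    quadForm (blockMat (a + b * t ^ 2) ((a - b) * t) (a * t ^ 2 + b) ^ p) ![1, (u : ℂ), w, 0] =
      ((a * (1 + t ^ 2)) ^ p * (1 + t * u) ^ 2 + (b * (1 + t ^ 2)) ^ p * (u - t) ^ 2) /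
        (1 + t ^ 2) + w ^ 2 := by
  set A := blockMat (a + b * t ^ 2) ((a - b) * t) (a * t ^ 2 + b) with hAdef
  have hA : 0 ≤ A := (posDef_blockMat ha hb t).posSemidef.nonneg
  have ht : 0 < 1 + t ^ 2 := by positivity
  have h1 := rpow_mulVec_eq_smul hA (c := a * (1 + t ^ 2)) (x := ![1, (t : ℂ), 0, 0])
    (by positivity) (by
      ext i; fin_cases i <;> simp [hAdef, blockMat, Matrix.mulVec, dotProduct, Fin.sum_univ_four]
        <;> ring) p
  have h2 := rpow_mulVec_eq_smul hA (c := b * (1 + t ^ 2)) (x := ![-(t : ℂ), 1, 0, 0])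
    (by positivity) (by
      ext i; fin_cases i <;> simp [hAdef, blockMat, Matrix.mulVec, dotProduct, Fin.sum_univ_four]
        <;> ring) p
  have h3 := rpow_mulVec_eq_smul hA (c := 1) (x := ![0, 0, 1, 0])
    zero_le_one (by
      ext i; fin_cases i <;> simp [hAdef, blockMat, Matrix.mulVec, dotProduct, Fin.sum_univ_four])
      p
  have htc : (1 + t ^ 2 : ℂ) ≠ 0 := by exact_mod_cast ht.ne'
  have hv : (![1, (u : ℂ), w, 0] : Fin 4 → ℂ) =
      (((1 + t * u) / (1 + t ^ 2) : ℝ) : ℂ) • ![1, (t : ℂ), 0, 0] +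
      (((u - t) / (1 + t ^ 2) : ℝ) : ℂ) • ![-(t : ℂ), 1, 0, 0] + (w : ℂ) • ![0, 0, 1, 0] := by
    ext i; fin_cases i <;> simp <;> field_simp <;> ring
  unfold quadForm
  have hAv : (A ^ p).mulVec ![1, (u : ℂ), w, 0] =
      (((1 + t * u) / (1 + t ^ 2) : ℝ) : ℂ) • ((((a * (1 + t ^ 2)) ^ p : ℝ) : ℂ) •
        ![1, (t : ℂ), 0, 0]) + (((u - t) / (1 + t ^ 2) : ℝ) : ℂ) •
        ((((b * (1 + t ^ 2)) ^ p : ℝ) : ℂ) • ![-(t : ℂ), 1, 0, 0]) +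
        (w : ℂ) • ![0, 0, 1, 0] := by
    conv_lhs => rw [hv]
    rw [Matrix.mulVec_add, Matrix.mulVec_add, Matrix.mulVec_smul, Matrix.mulVec_smul,
      Matrix.mulVec_smul, h1, h2, h3, Real.one_rpow, Complex.ofReal_one, one_smul]
  rw [hAv]
  generalize (a * (1 + t ^ 2)) ^ p = α
  generalize (b * (1 + t ^ 2)) ^ p = β
  have e : (star ![1, (u : ℂ), w, 0] ⬝ᵥ ((((1 + t * u) / (1 + t ^ 2) : ℝ) : ℂ) • ((α : ℂ) •
        ![1, (t : ℂ), 0, 0]) + (((u - t) / (1 + t ^ 2) : ℝ) : ℂ) •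
        ((β : ℂ) • ![-(t : ℂ), 1, 0, 0]) + (w : ℂ) • ![0, 0, 1, 0])) =
      (((α * (1 + t * u) ^ 2 + β * (u - t) ^ 2) / (1 + t ^ 2) + w ^ 2 : ℝ) : ℂ) := by
    simp [dotProduct, Fin.sum_univ_four]
    field_simp
    ring
  rw [e, Complex.ofReal_re]

theorem quadForm_blockMat_diag_rpow {a b : ℝ} (ha : 0 < a) (hb : 0 < b) (u w p : ℝ) :
    quadForm (blockMat a 0 b ^ p) ![1, (u : ℂ), w, 0] = a ^ p + b ^ p * u ^ 2 + w ^ 2 := by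
  simpa using quadForm_blockMat_rpow ha hb 0 u w p

theorem midpoint_blockMat (x y z x' z' : ℝ) :
    (2⁻¹ : ℝ) • (blockMat x y z + blockMat x' (-y) z') =
      blockMat ((x + x') / 2) 0 ((z + z') / 2) := by
  ext i j
  fin_cases i <;> fin_cases j <;> simp [blockMat] <;> ring

/-- The scalar inequality obtained from the two blocks with eigenvectors `(1, t)`, `(-t, 1)`,
whose off-diagonal entries cancel. -/
theorem block_inequality {p s : ℝ} (hs : 0 < s)
    (h : ∀ X ∈ P4, ConvexOn ℝ P4 (fun A => epsteinTrace p s X A)) {a a' b t t' : ℝ}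
    (ha : 0 < a) (ha' : 0 < a') (hb : 0 < b) (ht : (a' - b) * t' = -((a - b) * t)) (u : ℝ) :
    ((a + b * t ^ 2 + (a' + b * t' ^ 2)) / 2) ^ p ≤
      (((a * (1 + t ^ 2)) ^ p * (1 + t * u) ^ 2 + (b * (1 + t ^ 2)) ^ p * (u - t) ^ 2) /
        (1 + t ^ 2) +
      ((a' * (1 + t' ^ 2)) ^ p * (1 + t' * u) ^ 2 + (b * (1 + t' ^ 2)) ^ p * (u - t') ^ 2) /
        (1 + t' ^ 2)) / 2 := by
  have hD1 : 0 < (a + b * t ^ 2 + (a' + b * t' ^ 2)) / 2 := by positivity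
  have hD2 : 0 < (a * t ^ 2 + b + (a' * t' ^ 2 + b)) / 2 := by positivity
  -- The midpoint is diagonal. The contribution of its second entry is nonnegative and is given
  -- away; it would vanish in both limits taken later.
  refine le_trans (le_add_of_nonneg_right (b := ((a * t ^ 2 + b + (a' * t' ^ 2 + b)) / 2) ^ p *
    u ^ 2) (by positivity)) ?_
  refine le_midpoint_of_rpow_shift hs (by positivity) (by positivity) (by positivity)
    fun c hc => ?_
  -- The third coordinate meets the identity part of the blocks and contributes exactly the shift
  -- `c`.
  have hv : (![1, (u : ℂ), (√c : ℝ), 0] : Fin 4 → ℂ) ≠ 0 := fun h0 => by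
    simpa using congrFun h0 0
  have key := quadForm_rpow_midpoint_le hs h (posDef_blockMat ha hb t)
    (posDef_blockMat ha' hb t') hv
  rw [quadForm_blockMat_rpow ha hb, quadForm_blockMat_rpow ha' hb, ht, midpoint_blockMat,
    quadForm_blockMat_diag_rpow hD1 hD2, Real.sq_sqrt hc.le] at key
  exact key

/-! ### Scalar power inequalities and the bounds on `p` -/

theorem midpoint_rpow_lt_of_mem_Ioo {r : ℝ} (h0 : 0 < r) (h1 : r < 1) :
    (1 + (3 : ℝ) ^ r) / 2 < 2 ^ r := by
  have h := (Real.strictConcaveOn_rpow h0 h1).2 (x := 1) (y := 3) (by simp) (by simp) (by norm_num)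
    (by norm_num : (0 : ℝ) < 2⁻¹) (by norm_num : (0 : ℝ) < 2⁻¹) (by norm_num)
  norm_num at h
  linarith

theorem rpow_two_lt_midpoint_of_one_lt {r : ℝ} (h1 : 1 < r) :
    (2 : ℝ) ^ r < (1 + 3 ^ r) / 2 := by
  have h := (strictConvexOn_rpow h1).2 (x := 1) (y := 3) (by simp) (by simp) (by norm_num)
    (by norm_num : (0 : ℝ) < 2⁻¹) (by norm_num : (0 : ℝ) < 2⁻¹) (by norm_num)
  norm_num at h
  linarith

/-- AM–GM for 1 and `4^r`, together with `4^r < 3^r` for negative `r`. -/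
theorem rpow_two_lt_midpoint_of_neg {r : ℝ} (hr : r < 0) :
    (2 : ℝ) ^ r < (1 + 3 ^ r) / 2 := by
  have h4 : (2 : ℝ) ^ r * 2 ^ r < 3 ^ r := by
    rw [← Real.mul_rpow (by norm_num) (by norm_num)]
    exact Real.rpow_lt_rpow_of_neg (by norm_num) (by norm_num) hr
  nlinarith [sq_nonneg ((2 : ℝ) ^ r - 1)]

-- The degenerate limit of `block_inequality` with `a = 1`, `a' = 3`. The test parameter `u` may
-- blow up, provided `t u` and `t' u` converge and the terms with factor `b^p` vanish; the limits
-- `k`, `k'` tilt the two squares.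
open Filter Topology in
theorem tendsto_block_inequality {p s : ℝ} (hs : 0 < s)
    (h : ∀ X ∈ P4, ConvexOn ℝ P4 (fun A => epsteinTrace p s X A)) {b t t' u : ℝ → ℝ}
    {k k' d d' : ℝ} (hd : 0 ≤ d) (hd' : 0 ≤ d') (hb : ∀ᶠ y in 𝓝[>] 0, 0 < b y)
    (htt : ∀ᶠ y in 𝓝[>] 0, (3 - b y) * t' y = -((1 - b y) * t y))
    (ht : Tendsto t (𝓝[>] 0) (𝓝 0)) (ht' : Tendsto t' (𝓝[>] 0) (𝓝 0))
    (htu : Tendsto (fun y => t y * u y) (𝓝[>] 0) (𝓝 k))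
    (htu' : Tendsto (fun y => t' y * u y) (𝓝[>] 0) (𝓝 k'))
    (hbt : Tendsto (fun y => b y * t y ^ 2) (𝓝[>] 0) (𝓝 d))
    (hbt' : Tendsto (fun y => b y * t' y ^ 2) (𝓝[>] 0) (𝓝 d'))
    (hbu : Tendsto (fun y => b y ^ p * (u y - t y) ^ 2) (𝓝[>] 0) (𝓝 0))
    (hbu' : Tendsto (fun y => b y ^ p * (u y - t' y) ^ 2) (𝓝[>] 0) (𝓝 0)) :
    ((1 + d + (3 + d')) / 2) ^ p ≤ ((1 + k) ^ 2 + 3 ^ p * (1 + k') ^ 2) / 2 := by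
  have hL : Tendsto (fun y => ((1 + b y * t y ^ 2 + (3 + b y * t' y ^ 2)) / 2) ^ p) (𝓝[>] 0)
      (𝓝 (((1 + d + (3 + d')) / 2) ^ p)) :=
    (((hbt.const_add 1).add (hbt'.const_add 3)).div_const 2).rpow_const (Or.inl (by positivity))
  have term : ∀ {a κ : ℝ} {τ : ℝ → ℝ}, 0 < a → Tendsto τ (𝓝[>] 0) (𝓝 0) →
      Tendsto (fun y => τ y * u y) (𝓝[>] 0) (𝓝 κ) →
      Tendsto (fun y => b y ^ p * (u y - τ y) ^ 2) (𝓝[>] 0) (𝓝 0) →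
      Tendsto (fun y => ((a * (1 + τ y ^ 2)) ^ p * (1 + τ y * u y) ^ 2 +
        (1 + τ y ^ 2) ^ p * (b y ^ p * (u y - τ y) ^ 2)) / (1 + τ y ^ 2)) (𝓝[>] 0)
        (𝓝 (a ^ p * (1 + κ) ^ 2)) := by
    intro a κ τ ha hτ hτu hbτ
    have h1 : Tendsto (fun y => 1 + τ y ^ 2) (𝓝[>] 0) (𝓝 1) := by
      simpa using (hτ.pow 2).const_add 1
    have h2 : Tendsto (fun y => (1 + τ y ^ 2) ^ p) (𝓝[>] 0) (𝓝 1) := by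
      simpa using h1.rpow_const (p := p) (Or.inl one_ne_zero)
    have h3 : Tendsto (fun y => (a * (1 + τ y ^ 2)) ^ p) (𝓝[>] 0) (𝓝 (a ^ p)) := by
      simpa using (h1.const_mul a).rpow_const (p := p) (Or.inl (by simpa using ha.ne'))
    have h4 := ((h3.mul ((hτu.const_add 1).pow 2)).add (h2.mul hbτ)).div h1 one_ne_zero
    rw [mul_zero, add_zero, div_one] at h4
    exact h4
  have hR := ((term one_pos ht htu hbu).add (term three_pos ht' htu' hbu')).div_const 2
  rw [Real.one_rpow, one_mul] at hR
  refine le_of_tendsto_of_tendsto hL hR ?_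
  filter_upwards [hb, htt] with y hy hy'
  have key := block_inequality hs h one_pos three_pos hy hy' (u y)
  rw [Real.mul_rpow hy.le (by positivity), Real.mul_rpow hy.le (by positivity)] at key
  refine key.trans_eq ?_
  ring

open Filter Topology in
theorem tendsto_nhdsGT_of_continuousAt {f g : ℝ → ℝ} {c : ℝ} (hg : ContinuousAt g 0)
    (hc : g 0 = c) (hfg : ∀ y, 0 < y → y < 1 / 2 → f y = g y) :
    Tendsto f (𝓝[>] 0) (𝓝 c) := by
  rw [← hc]
  refine (hg.tendsto.mono_left nhdsWithin_le_nhds).congr' ?_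
  filter_upwards [Ioo_mem_nhdsGT (by norm_num : (0 : ℝ) < 1 / 2)] with y hy
  exact (hfg y hy.1 hy.2).symm

open Filter Topology in
theorem le_two_of_convexOn {p s : ℝ} (hs : 0 < s)
    (h : ∀ X ∈ P4, ConvexOn ℝ P4 (fun A => epsteinTrace p s X A)) : p ≤ 2 := by
  by_contra! hp
  have hIoo : ∀ᶠ y : ℝ in 𝓝[>] 0, y ∈ Set.Ioo (0 : ℝ) (1 / 2) :=
    Ioo_mem_nhdsGT (by norm_num)
  have main : ∀ κ : ℝ, (2 : ℝ) ^ p ≤ ((1 + κ) ^ 2 + 3 ^ p * (1 - κ / 3) ^ 2) / 2 := by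
    intro κ
    have hpow : ∀ {a : ℝ}, 1 ≤ a → ContinuousAt
        (fun y : ℝ => y ^ (p - 2) * (κ - y * (y / (a - y))) ^ 2) 0 := fun {a} ha => by
      refine (continuousAt_id.rpow_const (Or.inr (by linarith))).mul ?_
      have : a - 0 ≠ 0 := by linarith
      fun_prop (disch := assumption)
    have hpow' : ContinuousAt
        (fun y : ℝ => y ^ (p - 2) * (κ - y * -(y / (3 - y))) ^ 2) 0 := by
      refine (continuousAt_id.rpow_const (Or.inr (by linarith))).mul ?_
      have : (3 : ℝ) - 0 ≠ 0 := by norm_num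
      fun_prop (disch := assumption)
    have hpe : ∀ y τ : ℝ, 0 < y → y ^ p * (κ / y - τ) ^ 2 = y ^ (p - 2) * (κ - y * τ) ^ 2 := by
      intro y τ hy
      rw [Real.rpow_sub hy, Real.rpow_two]
      field_simp
    have h1 : (1 : ℝ) - 0 ≠ 0 := by norm_num
    have h3 : (3 : ℝ) - 0 ≠ 0 := by norm_num
    have h0 : (0 : ℝ) ^ (p - 2) = 0 := Real.zero_rpow (by linarith)
    -- Here `b = y → 0` and `t, t'` are of order `y`, so `u = κ/y` keeps `t u` and `t' u` finite,
    -- while `b^p u²` is of order `y^(p-2)` and vanishes because `p > 2`.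
    have := tendsto_block_inequality hs h (b := fun y => y) (t := fun y => y / (1 - y))
      (t' := fun y => -(y / (3 - y))) (u := fun y => κ / y) (k := κ) (k' := -(κ / 3))
      (d := 0) (d' := 0) le_rfl le_rfl (hIoo.mono fun y hy => hy.1)
      (hIoo.mono fun y hy => by
        have h1 : 1 - y ≠ 0 := by linarith [hy.2]
        have h3 : 3 - y ≠ 0 := by linarith [hy.2]
        field_simp)
      (tendsto_nhdsGT_of_continuousAt (g := fun y => y / (1 - y))
        (by fun_prop (disch := assumption)) (by simp) fun y _ _ => rfl)
      (tendsto_nhdsGT_of_continuousAt (g := fun y => -(y / (3 - y)))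
        (by fun_prop (disch := assumption)) (by simp) fun y _ _ => rfl)
      (tendsto_nhdsGT_of_continuousAt (g := fun y => κ / (1 - y))
        (by fun_prop (disch := assumption)) (by simp) fun y _ _ => by field_simp)
      (tendsto_nhdsGT_of_continuousAt (g := fun y => -(κ / (3 - y)))
        (by fun_prop (disch := assumption)) (by simp) fun y _ _ => by field_simp)
      (tendsto_nhdsGT_of_continuousAt (g := fun y => y * (y / (1 - y)) ^ 2)
        (by fun_prop (disch := assumption)) (by simp) fun y _ _ => rfl)
      (tendsto_nhdsGT_of_continuousAt (g := fun y => y * (-(y / (3 - y))) ^ 2)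
        (by fun_prop (disch := assumption)) (by simp) fun y _ _ => rfl)
      (tendsto_nhdsGT_of_continuousAt (hpow le_rfl) (by simp [h0]) fun y hy _ => hpe y _ hy)
      (tendsto_nhdsGT_of_continuousAt hpow' (by simp [h0]) fun y hy _ => hpe y _ hy)
    norm_num at this
    rw [sub_eq_add_neg]
    exact this
  have h3 : (3 : ℝ) ^ p = 9 * 3 ^ (p - 2) := by
    rw [Real.rpow_sub (by norm_num)]; norm_num; ring
  have h2 : (2 : ℝ) ^ p = 4 * 2 ^ (p - 2) := by
    rw [Real.rpow_sub (by norm_num)]; norm_num; ring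
  have hlt := rpow_two_lt_midpoint_of_neg (r := -(p - 2)) (by linarith)
  rw [Real.rpow_neg (by norm_num), Real.rpow_neg (by norm_num)] at hlt
  rw [h2, h3] at main
  have hx : (0 : ℝ) < 2 ^ (p - 2) := by positivity
  have hy : (0 : ℝ) < 3 ^ (p - 2) := by positivity
  generalize (2 : ℝ) ^ (p - 2) = x at *
  generalize (3 : ℝ) ^ (p - 2) = y at *
  -- This `κ` minimizes the right-hand side. The minimum turns the inequality into `x ≤ 2y/(1+y)`,
  -- the harmonic mean of 1 and `y`, against strict convexity of the power `-(p-2)`.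
  have key := main (4 * y / (1 + y) - 1)
  have e : ((1 + (4 * y / (1 + y) - 1)) ^ 2 + 9 * y * (1 - (4 * y / (1 + y) - 1) / 3) ^ 2) / 2 =
      8 * y / (1 + y) := by field_simp; ring
  rw [e, le_div_iff₀ (by positivity)] at key
  have : 2 * y < x * (y + 1) := by
    have := mul_lt_mul_of_pos_right hlt (mul_pos hx hy)
    field_simp at this
    linarith
  linarith

open Filter Topology in
theorem neg_one_le_of_convexOn {p s : ℝ} (hs : 0 < s)
    (h : ∀ X ∈ P4, ConvexOn ℝ P4 (fun A => epsteinTrace p s X A)) : -1 ≤ p := by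
  by_contra! hp
  have hIoo : ∀ᶠ y : ℝ in 𝓝[>] 0, y ∈ Set.Ioo (0 : ℝ) (1 / 2) :=
    Ioo_mem_nhdsGT (by norm_num)
  have main1 : ∀ κ δ : ℝ, 0 < δ →
      (2 + δ ^ 2 : ℝ) ^ p ≤ ((1 - κ) ^ 2 + 3 ^ p * (1 + κ) ^ 2) / 2 := by
    intro κ δ hδ
    have h1 : (0 : ℝ) ^ 2 - 1 ≠ 0 := by norm_num
    have h3 : 3 * (0 : ℝ) ^ 2 - 1 ≠ 0 := by norm_num
    have h0 : (0 : ℝ) ^ (-2 * p - 2) = 0 := Real.zero_rpow (by linarith)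
    have hrc : ContinuousAt (fun y : ℝ => y ^ (-2 * p - 2)) 0 :=
      continuousAt_id.rpow_const (Or.inr (by linarith))
    have hpe : ∀ y τ : ℝ, 0 < y → (1 / y ^ 2) ^ p * (κ / (δ * y) - τ) ^ 2 =
        y ^ (-2 * p - 2) * (κ / δ - y * τ) ^ 2 := by
      intro y τ hy
      have : (1 / y ^ 2) ^ p = y ^ (-2 * p) := by
        rw [one_div, ← Real.rpow_two, ← Real.rpow_neg hy.le, ← Real.rpow_mul hy.le]
      rw [this, Real.rpow_sub hy, Real.rpow_two]
      field_simp
    have hy1 : ∀ y : ℝ, 0 < y → y < 1 / 2 → y ^ 2 - 1 ≠ 0 := fun y _ _ => by nlinarith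
    have hy3 : ∀ y : ℝ, 0 < y → y < 1 / 2 → 3 * y ^ 2 - 1 ≠ 0 := fun y _ _ => by nlinarith
    -- Here `b = y⁻² → ∞`. With `u` of order `1/y`, the term `b^p u²` is of order `y^(-2p-2)` and
    -- vanishes because `p < -1`. Finite `t u` requires `t` of order `y`, so `b t²` leaves a residue
    -- `δ²`.
    have := tendsto_block_inequality hs h (b := fun y => 1 / y ^ 2)
      (t := fun y => δ * y / (y ^ 2 - 1))
      (t' := fun y => -(δ * y / (3 * y ^ 2 - 1))) (u := fun y => κ / (δ * y)) (k := -κ) (k' := κ)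
      (d := δ ^ 2) (d' := δ ^ 2) (by positivity) (by positivity)
      (hIoo.mono fun y hy => by have := hy.1; positivity)
      (hIoo.mono fun y hy => by
        have h0 := hy.1.ne'
        have h1 := hy1 y hy.1 hy.2
        have h3 := hy3 y hy.1 hy.2
        field_simp)
      (tendsto_nhdsGT_of_continuousAt (g := fun y => δ * y / (y ^ 2 - 1))
        (by fun_prop (disch := assumption)) (by simp) fun y _ _ => rfl)
      (tendsto_nhdsGT_of_continuousAt (g := fun y => -(δ * y / (3 * y ^ 2 - 1)))
        (by fun_prop (disch := assumption)) (by simp) fun y _ _ => rfl)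
      (tendsto_nhdsGT_of_continuousAt (g := fun y => κ / (y ^ 2 - 1))
        (by fun_prop (disch := assumption)) (by simp [div_neg]) fun y _ _ => by field_simp)
      (tendsto_nhdsGT_of_continuousAt (g := fun y => -(κ / (3 * y ^ 2 - 1)))
        (by fun_prop (disch := assumption)) (by simp [div_neg]) fun y _ _ => by field_simp)
      (tendsto_nhdsGT_of_continuousAt (g := fun y => (δ / (y ^ 2 - 1)) ^ 2)
        (by fun_prop (disch := assumption)) (by simp [div_neg]) fun y _ _ => by field_simp)
      (tendsto_nhdsGT_of_continuousAt (g := fun y => (δ / (3 * y ^ 2 - 1)) ^ 2)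
        (by fun_prop (disch := assumption)) (by simp [div_neg]) fun y _ _ => by field_simp)
      (tendsto_nhdsGT_of_continuousAt (g := fun y => y ^ (-2 * p - 2) *
          (κ / δ - y * (δ * y / (y ^ 2 - 1))) ^ 2)
        (hrc.mul (by fun_prop (disch := assumption))) (by simp only [h0, zero_mul]) fun y hy _ => hpe y _ hy)
      (tendsto_nhdsGT_of_continuousAt (g := fun y => y ^ (-2 * p - 2) *
          (κ / δ - y * -(δ * y / (3 * y ^ 2 - 1))) ^ 2)
        (hrc.mul (by fun_prop (disch := assumption))) (by simp only [h0, zero_mul]) fun y hy _ => hpe y _ hy)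
    have e : (1 + δ ^ 2 + (3 + δ ^ 2)) / 2 = 2 + δ ^ 2 := by ring
    rw [e] at this
    rw [sub_eq_add_neg]
    exact this
  -- The residue is removed by `δ → 0`, taken after the limit in `y`; the right-hand side does not
  -- depend on `δ`.
  have main : ∀ κ : ℝ, (2 : ℝ) ^ p ≤ ((1 - κ) ^ 2 + 3 ^ p * (1 + κ) ^ 2) / 2 := by
    intro κ
    have hc : ContinuousAt (fun δ : ℝ => (2 + δ ^ 2) ^ p) 0 :=
      ContinuousAt.rpow_const (by fun_prop) (Or.inl (by norm_num))
    refine le_of_tendsto (tendsto_nhdsGT_of_continuousAt hc (by simp) fun y _ _ => rfl) ?_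
    filter_upwards [self_mem_nhdsWithin] with δ hδ using main1 κ δ hδ
  have hlt := rpow_two_lt_midpoint_of_one_lt (r := -p) (by linarith)
  rw [Real.rpow_neg (by norm_num), Real.rpow_neg (by norm_num)] at hlt
  have hx : (0 : ℝ) < 2 ^ p := by positivity
  have hy : (0 : ℝ) < 3 ^ p := by positivity
  generalize (2 : ℝ) ^ p = x at *
  generalize (3 : ℝ) ^ p = y at *
  -- The minimizing `κ` again bounds `x = 2^p` by the harmonic mean of 1 and `y = 3^p`, against
  -- strict convexity of the power `-p > 1`.
  have key := main ((1 - y) / (1 + y))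
  have e : ((1 - (1 - y) / (1 + y)) ^ 2 + y * (1 + (1 - y) / (1 + y)) ^ 2) / 2 =
      2 * y / (1 + y) := by field_simp; ring
  rw [e, le_div_iff₀ (by positivity)] at key
  have : 2 * y < x * (y + 1) := by
    have := mul_lt_mul_of_pos_right hlt (mul_pos hx hy)
    field_simp at this
    linarith
  linarith

theorem posDef_smul_one {a : ℝ} (ha : 0 < a) : ((a : ℂ) • (1 : M4)).PosDef :=
  Matrix.PosDef.one.smul (by exact_mod_cast ha)

theorem one_le_of_midpoint_rpow {r : ℝ} (hr : 0 < r) (h : (2 : ℝ) ^ r ≤ (1 + 3 ^ r) / 2) :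
    1 ≤ r := by
  by_contra! h1
  exact (midpoint_rpow_lt_of_mem_Ioo hr h1).not_ge h

theorem one_le_of_convexOn {p s : ℝ} (hp : 0 < p) (hs : 0 < s)
    (h : ∀ X ∈ P4, ConvexOn ℝ P4 (fun A => epsteinTrace p s X A)) : 1 ≤ p := by
  -- Diagonal blocks with `u = 0` leave only the scalar midpoint inequality for `x^p` at 1 and 3.
  have key := block_inequality hs h (t := 0) (t' := 0) one_pos three_pos one_pos (by simp) 0
  norm_num at key
  exact one_le_of_midpoint_rpow hp key

theorem one_le_mul_of_convexOn {p s : ℝ} (hps : 0 < p * s)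
    (h : ConvexOn ℝ P4 (fun A => epsteinTrace p s 1 A)) : 1 ≤ p * s := by
  have key := h.map_midpoint (posDef_smul_one one_pos) (posDef_smul_one three_pos)
  have e : (2⁻¹ : ℝ) • (((1 : ℝ) : ℂ) • (1 : M4) + ((3 : ℝ) : ℂ) • 1) = ((2 : ℝ) : ℂ) • 1 := by
    rw [← add_smul, ← Complex.coe_smul, smul_smul]
    norm_num
  rw [e] at key
  rw [epsteinTrace_one_smul_one two_pos, epsteinTrace_one_smul_one one_pos,
    epsteinTrace_one_smul_one three_pos, Real.one_rpow] at key
  exact one_le_of_midpoint_rpow hps (by linarith)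

/-- The necessary conditions for convexity of `A ↦ Tr (X* A^p X)^s` when `s > 0`. -/
theorem epsteinTrace_convex_necessary {p s : ℝ} (hp : p ≠ 0) (hs : 0 < s)
    (h : ∀ X ∈ P4, ConvexOn ℝ P4 (fun A => epsteinTrace p s X A)) :
    (-1 ≤ p ∧ p < 0) ∨ ((1 ≤ p ∧ p ≤ 2) ∧ 1 / p ≤ s) := by
  rcases hp.lt_or_gt with hp | hp
  · exact Or.inl ⟨neg_one_le_of_convexOn hs h, hp⟩
  · refine Or.inr ⟨⟨one_le_of_convexOn hp hs h, le_two_of_convexOn hs h⟩, ?_⟩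
    rw [div_le_iff₀ hp, mul_comm]
    exact one_le_mul_of_convexOn (mul_pos hp hs) (h 1 Matrix.PosDef.one)

theorem epsteinTrace_neg_convex {p s : ℝ}
    (h : ∀ X ∈ P4, ConvexOn ℝ P4 (fun A => epsteinTrace p s X A)) :
    ∀ X ∈ P4, ConvexOn ℝ P4 (fun A => epsteinTrace (-p) (-s) X A) := fun X hX =>
  (h X⁻¹ (Matrix.PosDef.inv hX)).congr fun _ hA => (epsteinTrace_neg hX hA p s).symm

/-! ### Two variables: slices and scalar matrices -/

theorem exists_rpow_eq {X : M4} (hX : X.PosDef) {r : ℝ} (hr : r ≠ 0) :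
    ∃ A : M4, A.PosDef ∧ A ^ r = X :=
  ⟨X ^ r⁻¹, posDef_rpow hX _, CFC.rpow_inv_rpow X r hr hX.isStrictlyPositive⟩

theorem convexOn_slice_left {E F : Type*} [AddCommGroup E] [Module ℝ E] [AddCommGroup F]
    [Module ℝ F] {S : Set E} {T : Set F} {f : E × F → ℝ} (h : ConvexOn ℝ (S ×ˢ T) f) {y : F}
    (hy : y ∈ T) : ConvexOn ℝ S fun x => f (x, y) := by
  have e : ∀ (x x' : E) (a b : ℝ), a + b = 1 → a • (x, y) + b • (x', y) = (a • x + b • x', y) :=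
    fun x x' a b hab => by ext <;> simp [← add_smul, hab]
  refine ⟨fun x hx x' hx' a b ha hb hab => ?_, fun x hx x' hx' a b ha hb hab => ?_⟩
  · have := h.1 (Set.mk_mem_prod hx hy) (Set.mk_mem_prod hx' hy) ha hb hab
    rw [e _ _ _ _ hab] at this
    exact this.1
  · have := h.2 (Set.mk_mem_prod hx hy) (Set.mk_mem_prod hx' hy) ha hb hab
    rwa [e _ _ _ _ hab] at this

theorem convexOn_slice_right {E F : Type*} [AddCommGroup E] [Module ℝ E] [AddCommGroup F]
    [Module ℝ F] {S : Set E} {T : Set F} {f : E × F → ℝ} (h : ConvexOn ℝ (S ×ˢ T) f) {x : E}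
    (hx : x ∈ S) : ConvexOn ℝ T fun y => f (x, y) := by
  have e : ∀ (y y' : F) (a b : ℝ), a + b = 1 → a • (x, y) + b • (x, y') = (x, a • y + b • y') :=
    fun y y' a b hab => by ext <;> simp [← add_smul, hab]
  refine ⟨fun y hy y' hy' a b ha hb hab => ?_, fun y hy y' hy' a b ha hb hab => ?_⟩
  · have := h.1 (Set.mk_mem_prod hx hy) (Set.mk_mem_prod hx hy') ha hb hab
    rw [e _ _ _ _ hab] at this
    exact this.2
  · have := h.2 (Set.mk_mem_prod hx hy) (Set.mk_mem_prod hx hy') ha hb hab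
    rwa [e _ _ _ _ hab] at this

theorem epsteinTrace_convex_left {p q s : ℝ} (hq : q ≠ 0)
    (h : ConvexOn ℝ (P4 ×ˢ P4) (fun Z => liebTrace p q s Z)) :
    ∀ X ∈ P4, ConvexOn ℝ P4 (fun A => epsteinTrace p s X A) := fun X hX => by
  obtain ⟨B, hB, rfl⟩ := exists_rpow_eq hX (r := q / 2) (by simpa using hq)
  exact (convexOn_slice_left h hB).congr fun A hA => liebTrace_eq_epsteinTrace_left hA hB p q s

theorem epsteinTrace_convex_right {p q s : ℝ} (hp : p ≠ 0)
    (h : ConvexOn ℝ (P4 ×ˢ P4) (fun Z => liebTrace p q s Z)) :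
    ∀ X ∈ P4, ConvexOn ℝ P4 (fun B => epsteinTrace q s X B) := fun X hX => by
  obtain ⟨A, hA, rfl⟩ := exists_rpow_eq hX (r := p / 2) (by simpa using hp)
  exact (convexOn_slice_right h hA).congr fun B _ => liebTrace_eq_epsteinTrace_right hA p q s

theorem liebTrace_scalar_convex {p q s : ℝ}
    (h : ConvexOn ℝ (P4 ×ˢ P4) (fun Z => liebTrace p q s Z)) :
    ConvexOn ℝ (Set.Ioi (0 : ℝ) ×ˢ Set.Ioi (0 : ℝ))
      (fun z => z.1 ^ (p * s) * z.2 ^ (q * s)) := by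
  refine ⟨(convex_Ioi 0).prod (convex_Ioi 0), ?_⟩
  rintro ⟨x, y⟩ ⟨hx, hy⟩ ⟨x', y'⟩ ⟨hx', hy'⟩ a b ha hb hab
  have hX := (convex_Ioi (0 : ℝ)) hx hx' ha hb hab
  have hY := (convex_Ioi (0 : ℝ)) hy hy' ha hb hab
  have key := h.2 (Set.mk_mem_prod (posDef_smul_one hx) (posDef_smul_one hy))
    (Set.mk_mem_prod (posDef_smul_one hx') (posDef_smul_one hy')) ha hb hab
  have e : ∀ u v : ℝ, a • ((u : ℂ) • (1 : M4)) + b • ((v : ℂ) • (1 : M4)) =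
      ((a • u + b • v : ℝ) : ℂ) • 1 := fun u v => by
    rw [← Complex.coe_smul, ← Complex.coe_smul b, smul_smul, smul_smul, ← add_smul]
    simp
  dsimp only at key
  rw [Prod.smul_mk, Prod.smul_mk, Prod.mk_add_mk, e, e, liebTrace_smul_one hX hY,
    liebTrace_smul_one hx hy, liebTrace_smul_one hx' hy'] at key
  simp only [Prod.smul_mk, Prod.mk_add_mk, smul_eq_mul] at key ⊢
  linarith

theorem convexOn_prod_swap {f : ℝ × ℝ → ℝ}
    (h : ConvexOn ℝ (Set.Ioi (0 : ℝ) ×ˢ Set.Ioi (0 : ℝ)) f) :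
    ConvexOn ℝ (Set.Ioi (0 : ℝ) ×ˢ Set.Ioi (0 : ℝ)) (fun z => f z.swap) :=
  ⟨h.1, fun z hz w hw _ _ ha hb hab =>
    h.2 (x := z.swap) (y := w.swap) ⟨hz.2, hz.1⟩ ⟨hw.2, hw.1⟩ ha hb hab⟩

open Filter Topology in
/-- A convex `(a, b) ↦ a^x b^y` with `y > 0` has degree at least one. -/
theorem one_le_add_of_convexOn {x y : ℝ} (hy : 0 < y)
    (h : ConvexOn ℝ (Set.Ioi (0 : ℝ) ×ˢ Set.Ioi (0 : ℝ)) (fun z => z.1 ^ x * z.2 ^ y)) :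
    1 ≤ x + y := by
  by_contra! hd
  have h1 : ∀ δ : ℝ, 0 < δ → (1 + δ) ^ x * 2 ^ y ≤ 1 := by
    intro δ hδ
    have hL : ContinuousAt (fun ε : ℝ => (1 - ε + δ) ^ x * (2 - ε) ^ y) 0 :=
      (ContinuousAt.rpow_const (by fun_prop) (Or.inl (by simp; positivity))).mul
        (ContinuousAt.rpow_const (by fun_prop) (Or.inl (by simp)))
    have hR : ContinuousAt (fun ε : ℝ => 1 - ε + ε ^ (1 - (x + y)) * δ ^ x) 0 :=
      (by fun_prop : ContinuousAt (fun ε : ℝ => 1 - ε) 0).add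
        ((continuousAt_id.rpow_const (Or.inr (by linarith))).mul continuousAt_const)
    refine le_of_tendsto_of_tendsto
      (tendsto_nhdsGT_of_continuousAt hL (by simp) fun _ _ _ => rfl)
      (tendsto_nhdsGT_of_continuousAt hR
        (by rw [Real.zero_rpow (by linarith)]; simp) fun _ _ _ => rfl) ?_
    filter_upwards [Ioo_mem_nhdsGT (by norm_num : (0 : ℝ) < 1 / 2)] with ε hε
    obtain ⟨hε, hε2⟩ := hε
    -- A far point with weight `ε` shifts `(1, 1)` by nearly `(δ, 1)`, yet its weighted value is of
    -- order `ε^(1-(x+y))` and vanishes when the degree is below one. The positive `δ` keeps the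
    -- point in the open quadrant.
    have key := h.2 (x := (1, 1)) (y := (ε⁻¹ * δ, ε⁻¹)) (by simp)
      (by simp only [Set.mem_prod, Set.mem_Ioi]; constructor <;> positivity)
      (by linarith : 0 ≤ 1 - ε) hε.le (by ring)
    simp only [Prod.smul_mk, Prod.mk_add_mk, smul_eq_mul, mul_one, Real.one_rpow,
      mul_inv_cancel_left₀ hε.ne', mul_inv_cancel₀ hε.ne'] at key
    have e : ε * ((ε⁻¹ * δ) ^ x * ε⁻¹ ^ y) = ε ^ (1 - (x + y)) * δ ^ x := by
      rw [Real.mul_rpow (by positivity) hδ.le, Real.inv_rpow hε.le, Real.inv_rpow hε.le,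
        Real.rpow_sub hε, Real.rpow_one, Real.rpow_add hε]
      field_simp
    rw [e] at key
    convert key using 3
    ring
  have hc : ContinuousAt (fun δ : ℝ => (1 + δ) ^ x * 2 ^ y) 0 :=
    (ContinuousAt.rpow_const (by fun_prop) (Or.inl (by simp))).mul continuousAt_const
  have h2 : (2 : ℝ) ^ y ≤ 1 := by
    refine le_of_tendsto (tendsto_nhdsGT_of_continuousAt hc (by simp) fun _ _ _ => rfl) ?_
    filter_upwards [self_mem_nhdsWithin] with δ hδ using h1 δ hδ
  exact h2.not_gt (Real.one_lt_rpow one_lt_two hy)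

-- At `(δ, 1)` and `(1, δ)` the function tends to 0 as `δ → 0`, while at their midpoint it tends to
-- `2^(-x-y) > 0`.
open Filter Topology in
theorem not_convexOn_of_pos_of_pos {x y : ℝ} (hx : 0 < x) (hy : 0 < y) :
    ¬ ConvexOn ℝ (Set.Ioi (0 : ℝ) ×ˢ Set.Ioi (0 : ℝ)) (fun z => z.1 ^ x * z.2 ^ y) := by
  intro h
  have hL : ContinuousAt (fun δ : ℝ => (2⁻¹ * (δ + 1)) ^ x * (2⁻¹ * (1 + δ)) ^ y) 0 :=
    (ContinuousAt.rpow_const (by fun_prop) (Or.inr hx.le)).mul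
      (ContinuousAt.rpow_const (by fun_prop) (Or.inr hy.le))
  have hR : ContinuousAt (fun δ : ℝ => (δ ^ x + δ ^ y) / 2) 0 :=
    ((continuousAt_id.rpow_const (Or.inr hx.le)).add
      (continuousAt_id.rpow_const (Or.inr hy.le))).div_const 2
  have h0 : (2⁻¹ : ℝ) ^ x * 2⁻¹ ^ y ≤ 0 := by
    refine le_of_tendsto_of_tendsto
      (tendsto_nhdsGT_of_continuousAt hL (by simp) fun _ _ _ => rfl)
      (tendsto_nhdsGT_of_continuousAt hR
        (by simp [Real.zero_rpow hx.ne', Real.zero_rpow hy.ne']) fun _ _ _ => rfl) ?_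
    filter_upwards [self_mem_nhdsWithin] with δ hδ
    have hδ : 0 < δ := hδ
    have key := h.map_midpoint (x := (δ, 1)) (y := (1, δ)) (by simp [hδ]) (by simp [hδ])
    simpa using key
  have : 0 < (2⁻¹ : ℝ) ^ x * 2⁻¹ ^ y := by positivity
  linarith

/-- The necessary conditions for joint convexity of `(A, B) ↦ Tr (A^(p/2) B^q A^(p/2))^s` when
`s > 0`. -/
theorem liebTrace_convex_necessary {p q s : ℝ} (hp : p ≠ 0) (hq : q ≠ 0) (hs : 0 < s)
    (h : ConvexOn ℝ (P4 ×ˢ P4) (fun Z => liebTrace p q s Z)) :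
    ((-1 ≤ p ∧ p < 0) ∧ (-1 ≤ q ∧ q < 0)) ∨
      ((-1 ≤ p ∧ p < 0) ∧ (1 ≤ q ∧ q ≤ 2) ∧ 0 < p + q ∧ 1 / (p + q) ≤ s) ∨
      ((1 ≤ p ∧ p ≤ 2) ∧ (-1 ≤ q ∧ q < 0) ∧ 0 < p + q ∧ 1 / (p + q) ≤ s) := by
  have hsc := liebTrace_scalar_convex h
  have degree : 1 ≤ p * s + q * s → 0 < p + q ∧ 1 / (p + q) ≤ s := fun hd => by
    rw [← add_mul] at hd
    have hpq : 0 < p + q := pos_of_mul_pos_left (by linarith) hs.le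
    exact ⟨hpq, by rwa [div_le_iff₀ hpq, mul_comm]⟩
  rcases epsteinTrace_convex_necessary hp hs (epsteinTrace_convex_left hq h) with h1 | ⟨h1, -⟩ <;>
  rcases epsteinTrace_convex_necessary hq hs (epsteinTrace_convex_right hp h) with h2 | ⟨h2, -⟩
  · exact Or.inl ⟨h1, h2⟩
  · exact Or.inr (Or.inl ⟨h1, h2, degree
      (one_le_add_of_convexOn (mul_pos (by linarith) hs) hsc)⟩)
  · refine Or.inr (Or.inr ⟨h1, h2, degree ?_⟩)
    rw [add_comm]
    refine one_le_add_of_convexOn (mul_pos (by linarith) hs) ((convexOn_prod_swap hsc).congr ?_)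
    exact fun z _ => mul_comm _ _
  · exact absurd hsc (not_convexOn_of_pos_of_pos (mul_pos (by linarith) hs)
      (mul_pos (by linarith) hs))

theorem liebTrace_neg_convex {p q s : ℝ}
    (h : ConvexOn ℝ (P4 ×ˢ P4) (fun Z => liebTrace p q s Z)) :
    ConvexOn ℝ (P4 ×ˢ P4) (fun Z => liebTrace (-p) (-q) (-s) Z) :=
  h.congr fun _ hZ => (liebTrace_neg hZ.1 hZ.2 p q s).symm

theorem proposition4p4 :
    -- Part 1
    (∀ p s : ℝ, p ≠ 0 → s ≠ 0 →
      (∀ X ∈ P4, ConvexOn ℝ P4 (fun A => epsteinTrace p s X A)) →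
        ((-1 ≤ p ∧ p < 0) ∧ 0 < s) ∨
        ((1 ≤ p ∧ p ≤ 2) ∧ 1 / p ≤ s) ∨
        -- the same with (p, s) replaced by (-p, -s)
        ((-1 ≤ -p ∧ -p < 0) ∧ 0 < -s) ∨
        ((1 ≤ -p ∧ -p ≤ 2) ∧ 1 / (-p) ≤ -s)) ∧
    -- Part 2
    (∀ p q s : ℝ, p ≠ 0 → q ≠ 0 → s ≠ 0 →
      ConvexOn ℝ (P4 ×ˢ P4) (fun Z => liebTrace p q s Z) →
        ((-1 ≤ p ∧ p < 0) ∧ (-1 ≤ q ∧ q < 0) ∧ 0 < s) ∨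
        ((-1 ≤ p ∧ p < 0) ∧ (1 ≤ q ∧ q ≤ 2) ∧ 0 < p + q ∧ 1 / (p + q) ≤ s) ∨
        ((1 ≤ p ∧ p ≤ 2) ∧ (-1 ≤ q ∧ q < 0) ∧ 0 < p + q ∧ 1 / (p + q) ≤ s) ∨
        -- the same with (p, q, s) replaced by (-p, -q, -s)
        ((-1 ≤ -p ∧ -p < 0) ∧ (-1 ≤ -q ∧ -q < 0) ∧ 0 < -s) ∨
        ((-1 ≤ -p ∧ -p < 0) ∧ (1 ≤ -q ∧ -q ≤ 2) ∧ 0 < -p + -q ∧ 1 / (-p + -q) ≤ -s) ∨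
        ((1 ≤ -p ∧ -p ≤ 2) ∧ (-1 ≤ -q ∧ -q < 0) ∧ 0 < -p + -q ∧ 1 / (-p + -q) ≤ -s)) := by
  refine ⟨fun p s hp hs h => ?_, fun p q s hp hq hs h => ?_⟩
  · rcases hs.lt_or_gt with hs | hs
    · rcases epsteinTrace_convex_necessary (neg_ne_zero.2 hp) (neg_pos.2 hs)
        (epsteinTrace_neg_convex h) with h1 | h1
      · exact Or.inr (Or.inr (Or.inl ⟨h1, neg_pos.2 hs⟩))
      · exact Or.inr (Or.inr (Or.inr h1))
    · rcases epsteinTrace_convex_necessary hp hs h with h1 | h1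
      · exact Or.inl ⟨h1, hs⟩
      · exact Or.inr (Or.inl h1)
  · rcases hs.lt_or_gt with hs | hs
    · rcases liebTrace_convex_necessary (neg_ne_zero.2 hp) (neg_ne_zero.2 hq) (neg_pos.2 hs)
        (liebTrace_neg_convex h) with ⟨h1, h2⟩ | h1
      · exact Or.inr (Or.inr (Or.inr (Or.inl ⟨h1, h2, neg_pos.2 hs⟩)))
      · exact Or.inr (Or.inr (Or.inr (Or.inr h1)))
    · rcases liebTrace_convex_necessary hp hq hs h with ⟨h1, h2⟩ | h1 | h1
      · exact Or.inl ⟨h1, h2, hs⟩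
      · exact Or.inr (Or.inl h1)
      · exact Or.inr (Or.inr (Or.inl h1))
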